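/- Let the Euler numbers $E_0, E_1, E_2, \dots$ be the integers given by $E_0=1$, $E_{2n-1}=0$ and $\sum_{r=0}^{n}\binom{2n}{2r}E_{2r}=0$ for $n=1,2,3,\dots$. Let $b\ge 0$ be an even integer, and let $k\ge 1$ and $m\ge 3$ be integers. Then $$E_{2^m k+b}\equiv E_b-2^m k\left((b+1)^2+10+2^m k\,(b+1)\right)\pmod{2^{m+6}}.$$ -/

import Mathlib

/-- The Euler numbers, in the signed convention `E₀ = 1, E₂ = -1, E₄ = 5, E₆ = -61, …`:
`E₀ = 1`, `Eₙ = 0` for odd `n`, and for even `n > 0` the value `Eₙ` is determined by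
`∑_{r = 0}^{n/2} (n choose 2r) E_{2r} = 0`. -/
def eulerNumber (n : ℕ) : ℤ :=
  if n = 0 then 1
  else if Odd n then 0
  else -∑ r : Fin (n / 2), (n.choose (2 * (r : ℕ)) : ℤ) * eulerNumber (2 * (r : ℕ))
termination_by n
decreasing_by
  have := r.isLt
  omega

/-- The first defining relation of the Euler numbers. -/
theorem eulerNumber_zero : eulerNumber 0 = 1 := by
  rw [eulerNumber]; simp

/-- The second defining relation of the Euler numbers. -/
theorem eulerNumber_of_odd {n : ℕ} (hn : Odd n) : eulerNumber n = 0 := by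
  have h0 : n ≠ 0 := by rintro rfl; simp at hn
  rw [eulerNumber]; simp [hn, h0]

/-- The third defining relation of the Euler numbers. -/
theorem sum_choose_mul_eulerNumber {n : ℕ} (hn : 1 ≤ n) :
    ∑ r ∈ Finset.range (n + 1), ((2 * n).choose (2 * r) : ℤ) * eulerNumber (2 * r) = 0 := by
  have h0 : 2 * n ≠ 0 := by omega
  have h1 : ¬ Odd (2 * n) := by simp
  have key : eulerNumber (2 * n) =
      -∑ r ∈ Finset.range n, ((2 * n).choose (2 * r) : ℤ) * eulerNumber (2 * r) := by
    rw [eulerNumber, if_neg h0, if_neg h1,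
      Fin.sum_univ_eq_sum_range
        (fun r => ((2 * n).choose (2 * r) : ℤ) * eulerNumber (2 * r)) (2 * n / 2)]
    simp
  rw [Finset.sum_range_succ, Nat.choose_self, key]
  simp

open Polynomial Finset

/-! Let L send Xⁿ to Eₙ. The recurrence says L(f(X+1)) + L(f(X-1)) = 2f(0), which forces L(∏(X² -
(2i+1)²)) = ±(2r)!. These factorials are highly 2-divisible, and so are the iterated differences Δʲ
of n ↦ E₂ₙ (`two_pow_dvd_fwdDiff_iter_eulerMoment`). Newton's formula then expands E at 2(i+n) in
the terms C(n,j)Δʲ. Those with j ≥ 5 vanish (`two_pow_dvd_choose_mul_eulerDiff`), and those with j ≤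
4 are computed from explicit congruences for Δʲ. -/

/-- The umbral functional `Xⁿ ↦ Eₙ`. -/
noncomputable def eulerFunctional : ℤ[X] →ₗ[ℤ] ℤ :=
  Polynomial.lsum fun n => LinearMap.toSpanSingleton ℤ ℤ (eulerNumber n)

theorem eulerFunctional_X_pow (n : ℕ) : eulerFunctional (X ^ n) = eulerNumber n := by
  simp [eulerFunctional, Polynomial.X_pow_eq_monomial, Polynomial.lsum_apply]

/-- The sign factor kills each j of parity opposite to n, and Eⱼ = 0 kills odd j; only the defining
recurrence is left. -/
theorem sum_choose_mul_eulerNumber_mul_sign (n : ℕ) :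
    ∑ j ∈ range (n + 1), ((n.choose j : ℤ) * eulerNumber j) * (1 + (-1) ^ (n - j)) =
      2 * (0 : ℤ) ^ n := by
  rcases Nat.even_or_odd' n with ⟨m, rfl | rfl⟩
  · rw [show 2 * m + 1 = m + 1 + m by ring]
    have hs : ∀ j ∈ range (m + 1 + m),
        (((2 * m).choose j : ℤ) * eulerNumber j) * (1 + (-1) ^ (2 * m - j)) =
          if Even j then 2 * (((2 * m).choose j : ℤ) * eulerNumber j) else 0 := by
      intro j hj
      have hj' : j ≤ 2 * m := by simp at hj; omega
      split_ifs with h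
      · have : Even (2 * m - j) := by grind
        rw [this.neg_one_pow]; ring
      · rw [eulerNumber_of_odd (Nat.not_even_iff_odd.mp h)]; simp
    rw [sum_congr rfl hs, ← sum_filter]
    have : (range (m + 1 + m)).filter Even = (range (m + 1)).image (2 * ·) := by
      ext j
      simp only [mem_filter, mem_range, mem_image]
      constructor
      · rintro ⟨h1, c, rfl⟩
        exact ⟨c, by omega, by ring⟩
      · rintro ⟨c, hc, rfl⟩
        exact ⟨by omega, by simp⟩
    rw [this, sum_image (by intro a _ b _ h; simpa using h), ← mul_sum]
    rcases Nat.eq_zero_or_pos m with rfl | hm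
    · simp [eulerNumber_zero]
    · rw [sum_choose_mul_eulerNumber hm]
      simp [hm.ne']
  · rw [sum_eq_zero]
    · simp
    intro j hj
    have hj' : j ≤ 2 * m + 1 := by simp at hj; omega
    rcases Nat.even_or_odd j with h | h
    · have : Odd (2 * m + 1 - j) := by grind
      rw [this.neg_one_pow]; simp
    · rw [eulerNumber_of_odd h]; simp

theorem eulerFunctional_comp_add (f : ℤ[X]) :
    eulerFunctional (f.comp (X + 1)) + eulerFunctional (f.comp (X - 1)) = 2 * f.eval 0 := by
  induction f using Polynomial.induction_on' with
  | add p q hp hq => simp only [add_comp, map_add, eval_add]; linarith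
  | monomial n a =>
    have key : eulerFunctional ((X + 1) ^ n) + eulerFunctional ((X - 1) ^ n) = 2 * 0 ^ n := by
      have h (c : ℤ) : eulerFunctional ((X + C c) ^ n) =
          ∑ j ∈ range (n + 1), ((n.choose j : ℤ) * eulerNumber j) * c ^ (n - j) := by
        rw [add_pow, map_sum]
        refine sum_congr rfl fun j _ => ?_
        rw [show (X ^ j * C c ^ (n - j) * (n.choose j : ℤ[X])) =
            (c ^ (n - j) * (n.choose j : ℤ)) • (X ^ j : ℤ[X]) by
          simp [smul_eq_C_mul]; ring, map_smul, eulerFunctional_X_pow, smul_eq_mul]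
        ring
      have h1 := h 1
      have h2 := h (-1)
      simp only [map_neg, map_one, ← sub_eq_add_neg] at h1 h2
      rw [h1, h2, ← sum_choose_mul_eulerNumber_mul_sign, ← sum_add_distrib]
      exact sum_congr rfl fun j _ => by ring
    rw [← C_mul_X_pow_eq_monomial, ← smul_eq_C_mul]
    simp only [smul_comp, pow_comp, X_comp, map_smul, smul_eq_mul, eval_smul, eval_pow, eval_X]
    linear_combination a * key

/-! ### Central factorials and their Euler values -/

/-- The product of `X² - c²` over the first `r` odd numbers `c`. -/
noncomputable def oddCentralFactorial (r : ℕ) : ℤ[X] :=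
  ∏ i ∈ range r, (X ^ 2 - (2 * (i : ℤ[X]) + 1) ^ 2)

theorem oddCentralFactorial_succ (r : ℕ) : oddCentralFactorial (r + 1) =
    oddCentralFactorial r * (X ^ 2 - (2 * (r : ℤ[X]) + 1) ^ 2) := prod_range_succ _ _

/-- Shifting the roots 0, ±2, …, ±2r by -1 gives the odd numbers from -2r-1 to 2r-1. -/
theorem prod_sq_sub_comp_add_one (r : ℕ) :
    (X * ∏ i ∈ range r, (X ^ 2 - (2 * (i : ℤ[X]) + 2) ^ 2)).comp (X + 1) =
      oddCentralFactorial r * (X + 2 * (r : ℤ[X]) + 1) := by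
  induction r with
  | zero => simp [oddCentralFactorial]
  | succ r ih =>
    rw [prod_range_succ, ← mul_assoc, mul_comp, ih, oddCentralFactorial_succ]
    simp
    ring

theorem prod_sq_sub_comp_sub_one (r : ℕ) :
    (X * ∏ i ∈ range r, (X ^ 2 - (2 * (i : ℤ[X]) + 2) ^ 2)).comp (X - 1) =
      oddCentralFactorial r * (X - 2 * (r : ℤ[X]) - 1) := by
  induction r with
  | zero => simp [oddCentralFactorial]
  | succ r ih =>
    rw [prod_range_succ, ← mul_assoc, mul_comp, ih, oddCentralFactorial_succ]
    simp
    ring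

theorem eulerFunctional_oddCentralFactorial (r : ℕ) :
    eulerFunctional (oddCentralFactorial r) = (-1) ^ r * ((2 * r).factorial : ℤ) := by
  induction r with
  | zero => simpa [oddCentralFactorial, eulerNumber_zero] using eulerFunctional_X_pow 0
  | succ r ih =>
    -- The extra factor X makes the test polynomial even, so its two shifts sum to a combination of
    -- the central factorials r and r+1; its value at 0 is 0.
    have h := eulerFunctional_comp_add
      (X * (X * ∏ i ∈ range r, (X ^ 2 - (2 * (i : ℤ[X]) + 2) ^ 2)))
    rw [mul_comp, prod_sq_sub_comp_add_one, mul_comp, prod_sq_sub_comp_sub_one, ← map_add] at h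
    have h2 : (X : ℤ[X]).comp (X + 1) * (oddCentralFactorial r * (X + 2 * (r : ℤ[X]) + 1)) +
        (X : ℤ[X]).comp (X - 1) * (oddCentralFactorial r * (X - 2 * (r : ℤ[X]) - 1)) =
        (2 : ℤ) • oddCentralFactorial (r + 1) +
          (2 * ((2 * r + 1) * (2 * r + 2)) : ℤ) • oddCentralFactorial r := by
      rw [oddCentralFactorial_succ]
      simp [smul_eq_C_mul]
      ring
    rw [h2, map_add, map_smul, map_smul, ih] at h
    simp at h
    rw [show 2 * (r + 1) = 2 * r + 1 + 1 by ring, Nat.factorial_succ, Nat.factorial_succ, pow_succ]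
    push_cast
    linarith

/-! ### Moments, their differences and powers of 2 -/

/-- The values of the Euler functional at `X²ⁿ` times a central factorial. -/
noncomputable def eulerMoment (r n : ℕ) : ℤ :=
  eulerFunctional (X ^ (2 * n) * oddCentralFactorial r)

theorem eulerMoment_zero_left (n : ℕ) : eulerMoment 0 n = eulerNumber (2 * n) := by
  simp [eulerMoment, oddCentralFactorial, eulerFunctional_X_pow]

theorem eulerMoment_zero_right (r : ℕ) :
    eulerMoment r 0 = (-1) ^ r * ((2 * r).factorial : ℤ) := by
  simp [eulerMoment, eulerFunctional_oddCentralFactorial]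

theorem eulerMoment_succ (r n : ℕ) :
    eulerMoment r (n + 1) = eulerMoment (r + 1) n + (2 * r + 1) ^ 2 * eulerMoment r n := by
  have : (X ^ (2 * (n + 1)) * oddCentralFactorial r : ℤ[X]) =
      X ^ (2 * n) * oddCentralFactorial (r + 1) +
        ((2 * r + 1) ^ 2 : ℤ) • (X ^ (2 * n) * oddCentralFactorial r) := by
    rw [oddCentralFactorial_succ, smul_eq_C_mul]
    simp
    ring
  rw [eulerMoment, this, map_add, map_smul, smul_eq_mul, eulerMoment, eulerMoment]

theorem fwdDiff_eulerMoment (r : ℕ) :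
    fwdDiff 1 (eulerMoment r) = eulerMoment (r + 1) + (4 * r * (r + 1) : ℤ) • eulerMoment r := by
  ext n
  simp only [fwdDiff, eulerMoment_succ, Pi.add_apply, Pi.smul_apply, smul_eq_mul]
  ring

theorem fwdDiff_iter_succ_eulerMoment (j r : ℕ) :
    (fwdDiff 1)^[j + 1] (eulerMoment r) = (fwdDiff 1)^[j] (eulerMoment (r + 1)) +
      (4 * r * (r + 1) : ℤ) • (fwdDiff 1)^[j] (eulerMoment r) := by
  rw [Function.iterate_succ_apply, fwdDiff_eulerMoment, fwdDiff_iter_add,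
    fwdDiff_iter_const_smul]

theorem fwdDiff_iter_apply_add_one (f : ℕ → ℤ) (j i : ℕ) :
    (fwdDiff 1)^[j] f (i + 1) = (fwdDiff 1)^[j] f i + (fwdDiff 1)^[j + 1] f i := by
  rw [Function.iterate_succ_apply' (fwdDiff 1) j f, fwdDiff]
  ring

/-- A lower bound for the exponent of `2` in the central factorial moments. -/
def momentExponent (x : ℕ) : ℕ := x + if 4 ≤ x then 3 else if 2 ≤ x then 1 else 0

theorem two_pow_momentExponent_dvd_factorial (r : ℕ) :
    2 ^ momentExponent r ∣ (2 * r).factorial := by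
  rcases Nat.lt_or_ge r 4 with h | h
  · interval_cases r <;> decide
  · rw [momentExponent, if_pos h]
    induction r, h using Nat.le_induction with
    | base => decide
    | succ r hr ih =>
      rw [show 2 * (r + 1) = 2 * r + 1 + 1 by ring, Nat.factorial_succ, Nat.factorial_succ,
        show r + 1 + 3 = r + 3 + 1 by ring, pow_succ']
      exact mul_dvd_mul ⟨r + 1, by ring⟩ (ih.mul_left _)

/-- Each difference either raises r or contributes 4r(r+1), a multiple of 8; this suffices because
`momentExponent` grows by at most 3 per step. -/
theorem two_pow_dvd_fwdDiff_iter_eulerMoment (j r n : ℕ) :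
    2 ^ momentExponent (j + r) ∣ (fwdDiff 1)^[j] (eulerMoment r) n := by
  induction j generalizing r n with
  | zero =>
    rw [Function.iterate_zero, id, zero_add]
    induction n generalizing r with
    | zero =>
      rw [eulerMoment_zero_right]
      exact Dvd.dvd.mul_left (by exact_mod_cast two_pow_momentExponent_dvd_factorial r) _
    | succ n ih =>
      rw [eulerMoment_succ]
      refine dvd_add (dvd_trans (pow_dvd_pow _ ?_) (ih (r + 1))) ((ih r).mul_left _)
      unfold momentExponent
      split_ifs <;> omega
  | succ j ih =>
    rw [fwdDiff_iter_succ_eulerMoment, Pi.add_apply, Pi.smul_apply, smul_eq_mul]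
    refine dvd_add ?_ ?_
    · rw [add_right_comm, add_assoc]
      exact ih (r + 1) n
    · have h8 : (2 : ℤ) ^ 3 ∣ 4 * r * (r + 1) := by
        obtain ⟨c, hc⟩ := (Int.even_mul_succ_self (r : ℤ)).two_dvd
        exact ⟨c, by linear_combination 4 * hc⟩
      refine dvd_trans ?_ (mul_dvd_mul h8 (ih r n))
      rw [← pow_add]
      refine pow_dvd_pow _ ?_
      unfold momentExponent
      split_ifs <;> omega

/-! ### Explicit congruences for the low differences -/

/-- The iterated differences of `n ↦ E₂ₙ`. -/
noncomputable abbrev eulerDiff (j i : ℕ) : ℤ := (fwdDiff 1)^[j] (eulerMoment 0) i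

theorem eulerDiff_add_one (j i : ℕ) : eulerDiff j (i + 1) = eulerDiff j i + eulerDiff (j + 1) i :=
  fwdDiff_iter_apply_add_one _ j i

theorem two_pow_dvd_eulerDiff {j : ℕ} (hj : 4 ≤ j) (i : ℕ) : 2 ^ (j + 3) ∣ eulerDiff j i := by
  simpa [momentExponent, hj] using two_pow_dvd_fwdDiff_iter_eulerMoment j 0 i

theorem eulerDiff_zero_values :
    eulerDiff 1 0 = -2 ∧ eulerDiff 2 0 = 8 ∧ eulerDiff 3 0 = -80 ∧ eulerDiff 4 0 = 1664 ∧
      eulerDiff 5 0 = -58112 := by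
  norm_num [eulerDiff, fwdDiff_iter_succ_eulerMoment, fwdDiff_eulerMoment, eulerMoment_zero_right,
    Nat.factorial, -Function.iterate_succ]

/-- Start of a descent in j, each congruence being summed over i from its value at 0. The moduli are
chosen so that the errors become multiples of 512q after multiplication by 3C(4q,j). -/
theorem eulerDiff_five_modEq (i : ℕ) : eulerDiff 5 i ≡ 256 [ZMOD 512] := by
  induction i with
  | zero => rw [eulerDiff_zero_values.2.2.2.2]; decide
  | succ i ih =>
    rw [eulerDiff_add_one]
    have h := (two_pow_dvd_eulerDiff (j := 6) (by norm_num) i).modEq_zero_int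
    simpa using ih.add h

theorem eulerDiff_four_modEq (i : ℕ) : eulerDiff 4 i ≡ 128 + 256 * i [ZMOD 512] := by
  induction i with
  | zero => rw [eulerDiff_zero_values.2.2.2.1]; decide
  | succ i ih =>
    rw [eulerDiff_add_one]
    convert ih.add (eulerDiff_five_modEq i) using 1
    push_cast; ring

theorem eulerDiff_three_modEq (i : ℕ) : eulerDiff 3 i ≡ -80 + 128 * i [ZMOD 256] := by
  induction i with
  | zero => rw [eulerDiff_zero_values.2.2.1]; decide
  | succ i ih =>
    rw [eulerDiff_add_one]
    obtain ⟨c, hc⟩ := (eulerDiff_four_modEq i).symm.dvd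
    obtain ⟨d, hd⟩ := ih.symm.dvd
    refine (Int.modEq_iff_dvd.mpr ⟨d + 2 * c + i, ?_⟩ : _ ≡ _ [ZMOD 256]).symm
    push_cast
    linear_combination hc + hd

theorem eulerDiff_two_modEq (i : ℕ) :
    eulerDiff 2 i ≡ 8 - 80 * i + 64 * (i * (i - 1)) [ZMOD 256] := by
  induction i with
  | zero => rw [eulerDiff_zero_values.2.1]; decide
  | succ i ih =>
    rw [eulerDiff_add_one]
    convert ih.add (eulerDiff_three_modEq i) using 1
    push_cast; ring

theorem eulerDiff_one_modEq (i : ℕ) :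
    eulerDiff 1 i ≡ -2 + 8 * i - 40 * (i * (i - 1)) [ZMOD 128] := by
  induction i with
  | zero => rw [eulerDiff_zero_values.1]; decide
  | succ i ih =>
    rw [eulerDiff_add_one]
    obtain ⟨c, hc⟩ := (eulerDiff_two_modEq i).symm.dvd
    obtain ⟨d, hd⟩ := ih.symm.dvd
    obtain ⟨t, ht⟩ := (Int.even_mul_pred_self (i : ℤ)).two_dvd
    refine (Int.modEq_iff_dvd.mpr ⟨d + 2 * c + t, ?_⟩ : _ ≡ _ [ZMOD 128]).symm
    push_cast
    linear_combination hc + hd + 64 * ht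

/-! ### Newton expansion and conclusion -/

theorem add_four_le_of_two_pow_mul_odd {v w j : ℕ} (hj : 5 ≤ j) (h : j = 2 ^ v * w) (hw : Odd w) :
    v + 4 ≤ j := by
  have hw1 := hw.pos
  have hle : 2 ^ v ≤ j := h ▸ Nat.le_mul_of_pos_right _ hw1
  rcases Nat.lt_or_ge v 3 with hv | hv
  · interval_cases v <;> grind
  · refine le_trans ?_ hle
    clear h hle
    induction v, hv using Nat.le_induction with
    | base => norm_num
    | succ v hv ih => rw [pow_succ]; omega

/-- By j·C(n,j) = n·C(n-1,j-1), the binomial loses at most v = v₂(j) factors of 2 against n; the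
difference has j+3 ≥ v+7. -/
theorem two_pow_dvd_choose_mul_eulerDiff {s n j : ℕ} (hn : 2 ^ s ∣ n) (hj : 5 ≤ j) (i : ℕ) :
    (2 : ℤ) ^ (s + 7) ∣ n.choose j * eulerDiff j i := by
  rcases Nat.eq_zero_or_pos n with rfl | hpos
  · rw [Nat.choose_eq_zero_of_lt (by omega)]; simp
  obtain ⟨v, w, hw, hvw⟩ := Nat.exists_eq_two_pow_mul_odd (n := j) (by omega)
  have hv := add_four_le_of_two_pow_mul_odd hj hvw hw
  have hd : (2 : ℤ) ^ (7 + v) ∣ eulerDiff j i :=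
    (pow_dvd_pow _ (by omega)).trans (two_pow_dvd_eulerDiff (by omega) i)
  have hc : (n : ℤ) * (n - 1).choose (j - 1) = n.choose j * (2 ^ v * w) := by
    have := Nat.add_one_mul_choose_eq (n - 1) (j - 1)
    rw [Nat.sub_add_cancel hpos, Nat.sub_add_cancel (by omega), hvw] at this
    rw [hvw]
    exact_mod_cast this
  have hn' : (2 : ℤ) ^ s ∣ n * (n - 1).choose (j - 1) :=
    Dvd.dvd.mul_right (by exact_mod_cast hn) _
  have h := mul_dvd_mul hn' hd
  rw [hc, ← pow_add, show s + (7 + v) = v + (s + 7) by ring, pow_add,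
    show (n.choose j : ℤ) * (2 ^ v * w) * eulerDiff j i =
      2 ^ v * (n.choose j * eulerDiff j i * w) by ring] at h
  have h' := Int.dvd_of_mul_dvd_mul_left (by positivity) h
  refine IsCoprime.dvd_of_dvd_mul_right (IsCoprime.pow_left ?_) h'
  exact_mod_cast (Nat.isCoprime_iff_coprime (m := 2) (n := w)).mpr hw.coprime_two_left

theorem eulerDiff_zero_add {n : ℕ} (i s : ℕ) (hn : 2 ^ s ∣ n) (h4 : 4 ≤ n) :
    eulerNumber (2 * (i + n)) ≡ eulerNumber (2 * i) + n * eulerDiff 1 i +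
      n.choose 2 * eulerDiff 2 i + n.choose 3 * eulerDiff 3 i + n.choose 4 * eulerDiff 4 i
      [ZMOD 2 ^ (s + 7)] := by
  have h := shift_eq_sum_fwdDiff_iter 1 (eulerMoment 0) n i
  obtain ⟨p, hp⟩ := Nat.exists_eq_add_of_le h4
  rw [smul_eq_mul, mul_one, eulerMoment_zero_left, show n + 1 = 5 + p by omega,
    sum_range_add] at h
  have htail := dvd_sum fun x (_ : x ∈ range p) =>
    two_pow_dvd_choose_mul_eulerDiff hn (Nat.le_add_right 5 x) i
  rw [h]
  refine Int.ModEq.symm (Int.modEq_iff_dvd.mpr ?_)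
  have hhead : ∑ x ∈ range 5, n.choose x • (fwdDiff 1)^[x] (eulerMoment 0) i =
      eulerNumber (2 * i) + n * eulerDiff 1 i + n.choose 2 * eulerDiff 2 i +
        n.choose 3 * eulerDiff 3 i + n.choose 4 * eulerDiff 4 i := by
    rw [← eulerMoment_zero_left]
    simp only [sum_range_succ, range_zero, sum_empty, nsmul_eq_mul, Nat.choose_zero_right,
      Nat.choose_one_right, Nat.cast_one, one_mul, zero_add]
    rfl
  rw [hhead, add_sub_cancel_left]
  simpa only [nsmul_eq_mul] using htail

theorem two_mul_choose_two (n : ℕ) : 2 * (n.choose 2 : ℤ) = n * (n - 1) := by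
  induction n with
  | zero => simp
  | succ n ih =>
    rw [Nat.choose_succ_succ' n 1, Nat.choose_one_right]
    push_cast
    linear_combination ih

theorem six_mul_choose_three (n : ℕ) : 6 * (n.choose 3 : ℤ) = n * (n - 1) * (n - 2) := by
  induction n with
  | zero => simp
  | succ n ih =>
    rw [Nat.choose_succ_succ' n 2]
    push_cast
    linear_combination ih + 3 * two_mul_choose_two n

theorem twentyFour_mul_choose_four (n : ℕ) :
    24 * (n.choose 4 : ℤ) = n * (n - 1) * (n - 2) * (n - 3) := by
  induction n with
  | zero => simp
  | succ n ih =>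
    rw [Nat.choose_succ_succ' n 3]
    push_cast
    linear_combination ih + 4 * six_mul_choose_three n

theorem eulerNumber_two_mul_add_modEq (i q s : ℕ) (hq : 2 ^ s ∣ q) (hpos : 1 ≤ q) :
    eulerNumber (2 * (i + 4 * q)) ≡ eulerNumber (2 * i) -
      8 * q * ((2 * i + 1) ^ 2 + 10 + 8 * q * (2 * i + 1)) [ZMOD 2 ^ (s + 9)] := by
  have hn : 2 ^ (s + 2) ∣ 4 * q := by
    rw [pow_add, mul_comm]
    exact mul_dvd_mul_left 4 hq
  have h := eulerDiff_zero_add i (s + 2) hn (by omega)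
  refine h.trans (Int.ModEq.symm (Int.modEq_iff_dvd.mpr ?_))
  obtain ⟨a, ha⟩ := (eulerDiff_one_modEq i).symm.dvd
  obtain ⟨b, hb⟩ := (eulerDiff_two_modEq i).symm.dvd
  obtain ⟨c, hc⟩ := (eulerDiff_three_modEq i).symm.dvd
  obtain ⟨d, hd⟩ := (eulerDiff_four_modEq i).symm.dvd
  obtain ⟨t, ht⟩ := (Int.even_mul_pred_self (i : ℤ)).two_dvd
  have h2 := two_mul_choose_two (4 * q)
  have h3 := six_mul_choose_three (4 * q)
  have h4 := twentyFour_mul_choose_four (4 * q)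
  push_cast at h2 h3 h4 ⊢
  have h2' : ((4 * q).choose 2 : ℤ) = 2 * q * (4 * q - 1) := by linarith
  have h3' : 3 * ((4 * q).choose 3 : ℤ) = 4 * q * (4 * q - 1) * (2 * q - 1) := by linarith
  have h4' : 3 * ((4 * q).choose 4 : ℤ) = q * (4 * q - 1) * (2 * q - 1) * (4 * q - 3) := by linarith
  rw [sub_eq_iff_eq_add] at ha hb hc hd
  rw [ha, hb, hc, hd, h2', show s + 2 + 7 = s + 9 by ring]
  have hdvd : (2 : ℤ) ^ (s + 9) ∣ q * 512 := by
    rw [pow_add]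
    exact mul_dvd_mul (by exact_mod_cast hq) (by norm_num)
  -- Tripling is harmless modulo a power of 2 and clears the denominators in `h3'` and `h4'`; the
  -- witness below is the quotient by 512q.
  refine IsCoprime.dvd_of_dvd_mul_left (IsCoprime.pow_left (y := 3) ?_) (hdvd.trans ?_)
  · exact ⟨-1, 1, by norm_num⟩
  refine ⟨-1 - 3 * t + 10 * q + 5 * q * i + 3 * q * i ^ 2 - 17 * q ^ 2 - 24 * q ^ 2 * i +
    8 * q ^ 3 + 16 * q ^ 3 * i + 3 * a + 3 * (4 * q - 1) * b +
    (4 * q - 1) * (2 * q - 1) * (i + 2 * c) + (4 * q - 1) * (2 * q - 1) * (4 * q - 3) * d, ?_⟩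
  linear_combination (256 * c + (-80 + 128 * i)) * h3' + (512 * d + (128 + 256 * i)) * h4' -
    768 * q * ht

theorem corollary2p2 (b k m : ℕ) (hb : Even b) (hk : 1 ≤ k) (hm : 3 ≤ m) :
    eulerNumber (2 ^ m * k + b) ≡
      eulerNumber b - 2 ^ m * (k : ℤ) * (((b : ℤ) + 1) ^ 2 + 10 + 2 ^ m * (k : ℤ) * ((b : ℤ) + 1))
      [ZMOD 2 ^ (m + 6)] := by
  obtain ⟨i, rfl⟩ := hb.two_dvd
  -- With m = s+3, half the index shift is 4q for q = 2ˢk.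
  obtain ⟨s, rfl⟩ := Nat.exists_eq_add_of_le' hm
  have h := eulerNumber_two_mul_add_modEq i (2 ^ s * k) s (dvd_mul_right _ _)
    (Nat.mul_pos (by positivity) hk)
  rw [show 2 ^ (s + 3) * k + 2 * i = 2 * (i + 4 * (2 ^ s * k)) by ring]
  convert h using 2
  push_cast
  ring
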